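/- Let $\tau=\langle <, S;\ \min,\max\rangle$ be the vocabulary of binary strings ($<$ a binary and $S$ a unary relation symbol, $\min$ and $\max$ constants). For $n\ge 1$, a string $w=w_1\cdots w_n\in\{0,1\}^n$ is identified with the $\tau$-structure with universe $\{1,\dots,n\}$, the usual order as $<$, $S=\{i : w_i=1\}$, $\min=1$ and $\max=n$. A first-order $\tau$-sentence $\varphi$ separates $(\{w\},\{w'\})$ if $\varphi$ is true in $w$ and false in $w'$. The number of quantifiers of a sentence is the number of occurrences of quantifiers in it. $\log$ is the logarithm to base $2$. **Upper bound.** For all $n\ge 1$ and all $w,w'\in\{0,1\}^n$ with $w\ne w'$ there is a prenex first-order sentence $\varphi_{w,w'}$ that separates $(\{w\},\{w'\})$, has at most $\log(n)+6$ quantifiers, and whose quantifier prefix strictly alternates between $\exists$ and $\forall$ and ends with $\forall$. **Lower bound.** For all sufficiently large $n$ there are $w,w'\in\{0,1\}^n$ with $w\neq w'$ such that every first-order sentence (prenex or not) that separates $(\{w\},\{w'\})$ has at least $\lfloor\log(n)\rfloor$ quantifiers. -/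

import Mathlib

namespace BinString

/-- Function symbols of the vocabulary of binary strings: the constants `min` and `max`. -/
inductive Func : ℕ → Type
  | min : Func 0
  | max : Func 0

/-- Relation symbols of the vocabulary of binary strings: the binary symbol `<` and the unary
symbol `S` (the positions that carry the bit one). -/
inductive Rel : ℕ → Type
  | lt : Rel 2
  | S : Rel 1

/-- The vocabulary `⟨<, S; min, max⟩` of binary strings. -/
def lang : FirstOrder.Language.{0, 0} := ⟨Func, Rel⟩

/-- The structure that encodes the `n`-bit string `w`. The positions `1, …, n` of the string are
represented by `0, …, n - 1`; since there are constants, `n` is positive. -/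
@[reducible]
def toStructure {n : ℕ} [NeZero n] (w : Fin n → Bool) : lang.Structure (Fin n) where
  funMap := fun {_} f _ =>
    match f with
    | Func.min => ⟨0, Nat.pos_of_ne_zero (NeZero.ne n)⟩
    | Func.max => ⟨n - 1, Nat.sub_lt (Nat.pos_of_ne_zero (NeZero.ne n)) Nat.one_pos⟩
  RelMap := fun {_} r =>
    match r with
    | Rel.lt => fun x => x 0 < x 1
    | Rel.S => fun x => w (x 0) = true

/-- The sentence `φ` is true in the structure that encodes `w`. -/
def Satisfies {n : ℕ} [NeZero n] (w : Fin n → Bool) (φ : lang.Sentence) : Prop :=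
  @FirstOrder.Language.Sentence.Realize lang (Fin n) (toStructure w) φ

/-- `φ` is a separating sentence for `(A, B)`: true for every string in `A` and false for every
string in `B`. -/
def Separates {n : ℕ} [NeZero n] (φ : lang.Sentence) (A B : Set (Fin n → Bool)) : Prop :=
  (∀ w ∈ A, Satisfies w φ) ∧ ∀ w ∈ B, ¬ Satisfies w φ

/-- The number of quantifiers of a first-order formula (occurrences, not nesting depth). An
existential quantifier `∃` is the abbreviation `¬ ∀ ¬`, and so counts once. -/
def quantifierNumber {L : FirstOrder.Language.{0, 0}} {α : Type} : {k : ℕ} → L.BoundedFormula α k → ℕ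
  | _, .falsum => 0
  | _, .equal _ _ => 0
  | _, .rel _ _ => 0
  | _, .imp φ ψ => quantifierNumber φ + quantifierNumber ψ
  | _, .all φ => quantifierNumber φ + 1

/-- The two kinds of quantifiers. -/
inductive Quantifier
  | ex
  | all

/-- `HasPrefix P φ`: the formula `φ` is in prenex form `Q₁ x₁ … Qᵣ xᵣ ψ`, with `ψ` quantifier-free,
and its quantifier prefix `(Q₁, …, Qᵣ)` is `P`. -/
inductive HasPrefix {L : FirstOrder.Language.{0, 0}} {α : Type} :
    {k : ℕ} → List Quantifier → L.BoundedFormula α k → Prop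
  | qf {k : ℕ} {φ : L.BoundedFormula α k} (h : φ.IsQF) : HasPrefix [] φ
  | ex {k : ℕ} {P : List Quantifier} {φ : L.BoundedFormula α (k + 1)} (h : HasPrefix P φ) :
      HasPrefix (Quantifier.ex :: P) φ.ex
  | all {k : ℕ} {P : List Quantifier} {φ : L.BoundedFormula α (k + 1)} (h : HasPrefix P φ) :
      HasPrefix (Quantifier.all :: P) φ.all

/-- The prefix alternates: no two consecutive quantifiers are of the same kind. -/
def Alternating (P : List Quantifier) : Prop :=
  P.IsChain (fun a b => a ≠ b)

end BinString

namespace BinString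

open FirstOrder FirstOrder.Language

/-! Upper bound: if the strings differ at `i`, guess a position `x` with the right bit and verify
that `x` is at most `i` from the left end and at most `n - 1 - i` from the right end; together these
force `x = i`. One quantifier halves both distances at once. A conjunction of two bounds is tested
by `∀`: the position of the new point selects one of the bounds and leaves a disjunction of two
half-length bounds. A disjunction is tested by `∃` and leaves a conjunction. So the quantifiers
alternate, and the range doubles with each of them (`prefixDefinable_near`).

Lower bound: take strings with a single one, at `2 ^ r - 1` and at `2 ^ r`, where `r + 1 = ⌊log n⌋`.
The Duplicator survives `r` rounds of the Ehrenfeucht–Fraïssé game, with both ends as initial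
pebbles. Thresholds on distances halve each round (`Similar.exists_extend`). What saves the last
round is that a pebble may then land on the wrong side of the one, because no quantifier remains to
notice it (`Similar.exists_extend_last`). -/

/-- The formula `φ` holds in the structure of `w` under the assignment `xs`. -/
def Holds {n : ℕ} [NeZero n] {k : ℕ} (φ : lang.BoundedFormula Empty k) (w : Fin n → Bool)
    (xs : Fin k → Fin n) : Prop :=
  @BoundedFormula.Realize lang (Fin n) (toStructure w) Empty k φ default xs

/-! ### Properties definable by quantifier-free and prenex formulas -/

section Holds

variable {n : ℕ} [NeZero n] {k : ℕ} (w : Fin n → Bool) (xs : Fin k → Fin n)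

theorem satisfies_iff_holds (φ : lang.Sentence) : Satisfies w φ ↔ Holds φ w Fin.elim0 := by
  unfold Satisfies Holds Sentence.Realize Formula.Realize
  exact iff_of_eq (congrArg₂ (@BoundedFormula.Realize lang (Fin n) (toStructure w) Empty 0 φ)
    (Subsingleton.elim _ _) (Subsingleton.elim _ _))

theorem holds_bot : ¬ Holds (⊥ : lang.BoundedFormula Empty k) w xs := fun h => h

theorem holds_imp (φ ψ : lang.BoundedFormula Empty k) :
    Holds (φ.imp ψ) w xs ↔ (Holds φ w xs → Holds ψ w xs) := Iff.rfl

theorem holds_not (φ : lang.BoundedFormula Empty k) : Holds φ.not w xs ↔ ¬ Holds φ w xs := Iff.rfl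

theorem holds_all (φ : lang.BoundedFormula Empty (k + 1)) :
    Holds φ.all w xs ↔ ∀ x, Holds φ w (Fin.snoc xs x) := Iff.rfl

theorem holds_ex (φ : lang.BoundedFormula Empty (k + 1)) :
    Holds φ.ex w xs ↔ ∃ x, Holds φ w (Fin.snoc xs x) :=
  @BoundedFormula.realize_ex lang (Fin n) (toStructure w) _ _ _ _ _

theorem holds_inf (φ ψ : lang.BoundedFormula Empty k) :
    Holds (φ ⊓ ψ) w xs ↔ Holds φ w xs ∧ Holds ψ w xs :=
  @BoundedFormula.realize_inf lang (Fin n) (toStructure w) _ _ _ _ _ _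

theorem holds_liftAt (φ : lang.BoundedFormula Empty k) (ys : Fin (k + 1) → Fin n) :
    Holds (φ.liftAt 1 k) w ys ↔ Holds φ w (ys ∘ Fin.castSucc) :=
  @BoundedFormula.realize_liftAt_one_self lang (Fin n) (toStructure w) _ _ _ _ _

end Holds

/-- A function of the assignment that is the value of a term in every string of length `n`. -/
def IsPoint {n : ℕ} [NeZero n] {k : ℕ} (p : (Fin k → Fin n) → Fin n) : Prop :=
  ∃ t : lang.Term (Empty ⊕ Fin k), ∀ (w : Fin n → Bool) (xs : Fin k → Fin n),
    @Term.realize lang (Fin n) (toStructure w) _ (Sum.elim default xs) t = p xs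

/-- A property of strings and assignments that a quantifier-free formula defines. -/
def QFDefinable {n : ℕ} [NeZero n] {k : ℕ} (χ : (Fin n → Bool) → (Fin k → Fin n) → Prop) : Prop :=
  ∃ φ : lang.BoundedFormula Empty k, φ.IsQF ∧ ∀ w xs, Holds φ w xs ↔ χ w xs

/-- A property of strings and assignments that a prenex formula with prefix `P` defines. -/
def PrefixDefinable {n : ℕ} [NeZero n] : List Quantifier → {k : ℕ} →
    ((Fin n → Bool) → (Fin k → Fin n) → Prop) → Prop
  | [], _, χ => QFDefinable χ
  | .ex :: P, k, χ => ∃ χ' : (Fin n → Bool) → (Fin (k + 1) → Fin n) → Prop,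
      PrefixDefinable P χ' ∧ ∀ w xs, χ w xs ↔ ∃ x, χ' w (Fin.snoc xs x)
  | .all :: P, k, χ => ∃ χ' : (Fin n → Bool) → (Fin (k + 1) → Fin n) → Prop,
      PrefixDefinable P χ' ∧ ∀ w xs, χ w xs ↔ ∀ x, χ' w (Fin.snoc xs x)

theorem snoc_comp_castSucc {n k : ℕ} (xs : Fin k → Fin n) (x : Fin n) :
    (Fin.snoc xs x : Fin (k + 1) → Fin n) ∘ Fin.castSucc = xs := by
  funext i
  simp

section Definability

variable {n : ℕ} [NeZero n] {k : ℕ}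

theorem isPoint_var (i : Fin k) : IsPoint (n := n) fun xs => xs i :=
  ⟨.var (Sum.inr i), fun _ _ => rfl⟩

theorem isPoint_min : IsPoint (k := k) fun _ => (⟨0, Nat.pos_of_ne_zero (NeZero.ne n)⟩ : Fin n) :=
  ⟨.func (l := 0) (Func.min : lang.Functions 0) Fin.elim0, fun _ _ => rfl⟩

theorem isPoint_max : IsPoint (k := k)
    fun _ => (⟨n - 1, Nat.sub_lt (Nat.pos_of_ne_zero (NeZero.ne n)) Nat.one_pos⟩ : Fin n) :=
  ⟨.func (l := 0) (Func.max : lang.Functions 0) Fin.elim0, fun _ _ => rfl⟩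

theorem IsPoint.lift {p : (Fin k → Fin n) → Fin n} (hp : IsPoint p) :
    IsPoint fun ys : Fin (k + 1) → Fin n => p (ys ∘ Fin.castSucc) := by
  obtain ⟨t, ht⟩ := hp
  refine ⟨t.relabel (Sum.map id Fin.castSucc), fun w ys => ?_⟩
  refine (@Term.realize_relabel lang (Fin n) (toStructure w) _ _ _ _ _).trans (Eq.trans ?_ (ht w _))
  congr 1
  funext s
  rcases s with s | s
  · exact s.elim
  · rfl

theorem QFDefinable.lt {p q : (Fin k → Fin n) → Fin n} (hp : IsPoint p) (hq : IsPoint q) :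
    QFDefinable fun _ xs => p xs < q xs := by
  obtain ⟨t, ht⟩ := hp
  obtain ⟨s, hs⟩ := hq
  refine ⟨.rel (l := 2) (Rel.lt : lang.Relations 2) ![t, s],
    .of_isAtomic (.rel _ _), fun w xs => ?_⟩
  simp only [← ht w, ← hs w]
  rfl

theorem QFDefinable.bit {p : (Fin k → Fin n) → Fin n} (hp : IsPoint p) :
    QFDefinable fun w xs => w (p xs) = true := by
  obtain ⟨t, ht⟩ := hp
  refine ⟨.rel (l := 1) (Rel.S : lang.Relations 1) ![t],
    .of_isAtomic (.rel _ _), fun w xs => ?_⟩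
  simp only [← ht w]
  rfl

theorem QFDefinable.not {χ : (Fin n → Bool) → (Fin k → Fin n) → Prop} (h : QFDefinable χ) :
    QFDefinable fun w xs => ¬ χ w xs := by
  obtain ⟨φ, hφ, h⟩ := h
  exact ⟨φ.not, hφ.not, fun w xs => (holds_not w xs φ).trans (not_congr (h w xs))⟩

theorem QFDefinable.and {χ χ' : (Fin n → Bool) → (Fin k → Fin n) → Prop} (h : QFDefinable χ)
    (h' : QFDefinable χ') : QFDefinable fun w xs => χ w xs ∧ χ' w xs := by
  obtain ⟨φ, hφ, h⟩ := h
  obtain ⟨ψ, hψ, h'⟩ := h'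
  exact ⟨φ ⊓ ψ, hφ.inf hψ, fun w xs =>
    (holds_inf w xs φ ψ).trans (and_congr (h w xs) (h' w xs))⟩

theorem QFDefinable.const (c : Prop) :
    QFDefinable fun (_ : Fin n → Bool) (_ : Fin k → Fin n) => c := by
  by_cases hc : c
  · exact ⟨(⊥ : lang.BoundedFormula Empty k).not, BoundedFormula.isQF_bot.not, fun w xs =>
      iff_of_true (holds_bot w xs) hc⟩
  · exact ⟨⊥, BoundedFormula.isQF_bot, fun w xs => iff_of_false (holds_bot w xs) hc⟩

theorem QFDefinable.congr {χ χ' : (Fin n → Bool) → (Fin k → Fin n) → Prop} (h : QFDefinable χ)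
    (e : ∀ w xs, χ' w xs ↔ χ w xs) : QFDefinable χ' := by
  obtain ⟨φ, hφ, h⟩ := h
  exact ⟨φ, hφ, fun w xs => (h w xs).trans (e w xs).symm⟩

theorem QFDefinable.cond {γ χ χ' : (Fin n → Bool) → (Fin k → Fin n) → Prop} (hγ : QFDefinable γ)
    (h : QFDefinable χ) (h' : QFDefinable χ') :
    QFDefinable fun w xs => (γ w xs ∧ χ w xs) ∨ (¬ γ w xs ∧ χ' w xs) :=
  ((hγ.and h).not.and (hγ.not.and h').not).not.congr fun w xs => by tauto

theorem QFDefinable.lift {χ : (Fin n → Bool) → (Fin k → Fin n) → Prop} (h : QFDefinable χ) :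
    QFDefinable fun w (ys : Fin (k + 1) → Fin n) => χ w (ys ∘ Fin.castSucc) := by
  obtain ⟨φ, hφ, h⟩ := h
  exact ⟨φ.liftAt 1 k, hφ.liftAt, fun w ys => (holds_liftAt w φ ys).trans (h w _)⟩

theorem PrefixDefinable.congr {P : List Quantifier} {χ χ' : (Fin n → Bool) → (Fin k → Fin n) → Prop}
    (h : PrefixDefinable P χ) (e : ∀ w xs, χ' w xs ↔ χ w xs) : PrefixDefinable P χ' := by
  have : χ' = χ := by
    funext w xs
    exact propext (e w xs)
  exact this ▸ h

theorem prefixDefinable_const (P : List Quantifier) (c : Prop) {k : ℕ} :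
    PrefixDefinable P fun (_ : Fin n → Bool) (_ : Fin k → Fin n) => c := by
  induction P generalizing k with
  | nil => exact QFDefinable.const c
  | cons q P ih =>
    cases q
    · exact ⟨fun _ _ => c, ih, fun w xs => by simp⟩
    · exact ⟨fun _ _ => c, ih, fun w xs => by simp⟩

/-- Prenex formulas with the same prefix can be combined by a quantifier-free case distinction. -/
theorem PrefixDefinable.cond {P : List Quantifier} {k : ℕ}
    {γ χ χ' : (Fin n → Bool) → (Fin k → Fin n) → Prop}
    (hγ : QFDefinable γ) (h : PrefixDefinable P χ) (h' : PrefixDefinable P χ') :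
    PrefixDefinable P fun w xs => (γ w xs ∧ χ w xs) ∨ (¬ γ w xs ∧ χ' w xs) := by
  induction P generalizing k with
  | nil => exact QFDefinable.cond hγ h h'
  | cons q P ih =>
    cases q
    all_goals
      obtain ⟨δ, hδ, e⟩ := h
      obtain ⟨δ', hδ', e'⟩ := h'
      refine ⟨_, ih hγ.lift hδ hδ', fun w xs => ?_⟩
      simp only [snoc_comp_castSucc, e, e']
      by_cases hc : γ w xs <;> simp [hc]

theorem PrefixDefinable.exists_formula {P : List Quantifier} {k : ℕ}
    {χ : (Fin n → Bool) → (Fin k → Fin n) → Prop} (h : PrefixDefinable P χ) :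
    ∃ φ : lang.BoundedFormula Empty k, HasPrefix P φ ∧ quantifierNumber φ = P.length ∧
      ∀ w xs, Holds φ w xs ↔ χ w xs := by
  induction P generalizing k with
  | nil =>
    obtain ⟨φ, hφ, h⟩ := h
    refine ⟨φ, .qf hφ, ?_, h⟩
    clear h
    induction hφ with
    | falsum => rfl
    | of_isAtomic h => cases h <;> rfl
    | imp _ _ h₁ h₂ => simp_all [quantifierNumber]
  | cons q P ih =>
    cases q
    all_goals
      obtain ⟨δ, hδ, e⟩ := h
      obtain ⟨φ, hφ, hc, hr⟩ := ih hδ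
    · refine ⟨φ.ex, .ex hφ, ?_, fun w xs => ?_⟩
      · simp [quantifierNumber, hc]
      · rw [holds_ex, e]
        exact exists_congr fun x => hr _ _
    · refine ⟨φ.all, .all hφ, by simp [quantifierNumber, hc], fun w xs => ?_⟩
      rw [holds_all, e]
      exact forall_congr' fun x => hr _ _

end Definability

/-! ### Measuring distances with alternating quantifiers -/

/-- The prefix `∀ ∃ ∀ ⋯ ∃ ∀` of length `2 j + 1`. -/
def alternatingPrefix : ℕ → List Quantifier
  | 0 => [.all]
  | j + 1 => .all :: .ex :: alternatingPrefix j

theorem length_alternatingPrefix (j : ℕ) : (alternatingPrefix j).length = 2 * j + 1 := by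
  induction j with
  | zero => rfl
  | succ j ih => simp [alternatingPrefix, ih]; ring

theorem alternating_ex_cons_alternatingPrefix (j : ℕ) :
    Alternating (.ex :: alternatingPrefix j) := by
  unfold Alternating
  induction j with
  | zero => simp [alternatingPrefix]
  | succ j ih => simp [alternatingPrefix, ih]

theorem getLast?_cons_alternatingPrefix (j : ℕ) (q : Quantifier) :
    (q :: alternatingPrefix j).getLast? = some .all := by
  induction j generalizing q with
  | zero => rfl
  | succ j ih =>
    rw [alternatingPrefix, List.getLast?_cons_cons, List.getLast?_cons_cons]
    exact ih _

/-- The largest distance that the prefix `alternatingPrefix j` can measure. -/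
def distanceBound : ℕ → ℕ
  | 0 => 1
  | j + 1 => 4 * distanceBound j + 1

theorem three_mul_distanceBound (j : ℕ) : 3 * distanceBound j + 1 = 4 ^ (j + 1) := by
  induction j with
  | zero => rfl
  | succ j ih => rw [distanceBound, pow_succ, ← ih]; ring

section Distance

variable {n : ℕ} [NeZero n] {k : ℕ}

/-- A point between two others bounds their distance: an existential quantifier halves it. -/
theorem prefixDefinable_ex_near {P : List Quantifier} {m₁ m₂ M : ℕ}
    (ih : ∀ {k : ℕ} {a c b : (Fin k → Fin n) → Fin n} {m₁ m₂ : ℕ}, IsPoint a → IsPoint c →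
      IsPoint b → m₁ ≤ M → m₂ ≤ M → PrefixDefinable P fun _ xs =>
        (c xs : ℕ) ≤ a xs + m₁ ∧ (b xs : ℕ) ≤ c xs + m₂)
    {a c b : (Fin k → Fin n) → Fin n} (ha : IsPoint a) (hc : IsPoint c) (hb : IsPoint b)
    (h₁ : m₁ ≤ 2 * M) (h₂ : m₂ ≤ 2 * M) :
    PrefixDefinable (.ex :: P) fun _ xs =>
      ((a xs : ℕ) < c xs ∧ (c xs : ℕ) ≤ a xs + m₁) ∨
        ((c xs : ℕ) < b xs ∧ (b xs : ℕ) ≤ c xs + m₂) := by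
  have z : IsPoint (n := n) fun ys : Fin (k + 1) → Fin n => ys (Fin.last k) := isPoint_var _
  refine ⟨_, .cond ((QFDefinable.lt ha.lift z).and (QFDefinable.lt hc.lift z).not)
    (ih (m₁ := (m₁ + 1) / 2) (m₂ := m₁ / 2) ha.lift z hc.lift (by omega) (by omega))
    (.cond ((QFDefinable.lt hc.lift z).and (QFDefinable.lt hb.lift z).not)
      (ih (m₁ := (m₂ + 1) / 2) (m₂ := m₂ / 2) hc.lift z hb.lift (by omega) (by omega))
      (prefixDefinable_const P False)), fun w xs => ?_⟩
  simp only [snoc_comp_castSucc, Fin.snoc_last, Fin.lt_def, and_false, or_false]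
  generalize a xs = a, b xs = b, c xs = c
  constructor
  · rintro (⟨h, h'⟩ | ⟨h, h'⟩)
    -- Rounding up keeps the midpoint to the right of `a` even when `m₁ = 1`.
    · refine ⟨⟨min (a + (m₁ + 1) / 2) c, by omega⟩, ?_⟩
      simp only
      omega
    · refine ⟨⟨min (c + (m₂ + 1) / 2) b, by omega⟩, ?_⟩
      simp only
      omega
  · rintro ⟨x, hx⟩
    omega

/-- Dually, a universal quantifier splits a distance in two. -/
theorem prefixDefinable_all_near {P : List Quantifier} {m₁ m₂ M : ℕ}
    (ih : ∀ {k : ℕ} {a c b : (Fin k → Fin n) → Fin n} {m₁ m₂ : ℕ}, IsPoint a → IsPoint c →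
      IsPoint b → m₁ ≤ M → m₂ ≤ M → PrefixDefinable P fun _ xs =>
        ((a xs : ℕ) < c xs ∧ (c xs : ℕ) ≤ a xs + m₁) ∨
          ((c xs : ℕ) < b xs ∧ (b xs : ℕ) ≤ c xs + m₂))
    {a c b : (Fin k → Fin n) → Fin n} (ha : IsPoint a) (hc : IsPoint c) (hb : IsPoint b)
    (h₁ : m₁ ≤ 2 * M + 1) (h₂ : m₂ ≤ 2 * M + 1) :
    PrefixDefinable (.all :: P) fun _ xs =>
      (c xs : ℕ) ≤ a xs + m₁ ∧ (b xs : ℕ) ≤ c xs + m₂ := by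
  have z : IsPoint (n := n) fun ys : Fin (k + 1) → Fin n => ys (Fin.last k) := isPoint_var _
  -- The bound `0` is tested directly: for `c = a + 1` there is no point in between, so the halving
  -- test would hold vacuously.
  refine ⟨_, .cond ((QFDefinable.lt ha.lift hc.lift).and (.const (m₁ = 0)))
    (prefixDefinable_const P False) <|
    .cond ((QFDefinable.lt hc.lift hb.lift).and (.const (m₂ = 0)))
    (prefixDefinable_const P False) <|
    .cond ((QFDefinable.lt ha.lift z).and (QFDefinable.lt z hc.lift))
    (ih (m₁ := m₁ / 2) (m₂ := (m₁ - 1) / 2) ha.lift z hc.lift (by omega) (by omega)) <|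
    .cond ((QFDefinable.lt hc.lift z).and (QFDefinable.lt z hb.lift))
    (ih (m₁ := m₂ / 2) (m₂ := (m₂ - 1) / 2) hc.lift z hb.lift (by omega) (by omega)) <|
    prefixDefinable_const P True, fun w xs => ?_⟩
  simp only [snoc_comp_castSucc, Fin.snoc_last, Fin.lt_def, and_false, false_or, and_true]
  generalize a xs = a, b xs = b, c xs = c
  constructor
  · intro h x
    omega
  · intro h
    constructor
    · by_contra! h'
      rcases Nat.eq_zero_or_pos m₁ with rfl | h0
      · have := h a
        omega
      -- The first point too far from `a`; it is also too far from `c`, since `m₁ - m₁ / 2 > (m₁ -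
      -- 1) / 2`.
      · have := h ⟨a + m₁ / 2 + 1, by omega⟩
        simp only at this
        omega
    · by_contra! h'
      rcases Nat.eq_zero_or_pos m₂ with rfl | h0
      · have := h c
        omega
      · have := h ⟨c + m₂ / 2 + 1, by omega⟩
        simp only at this
        omega

/-- A range `M` becomes `2 * M` under `∃` and then `2 * (2 * M) + 1` under `∀`, which is the
recursion of `distanceBound`. The innermost `∀` alone handles the bounds `0` and `1`. -/
theorem prefixDefinable_near (j : ℕ) {k : ℕ} {a c b : (Fin k → Fin n) → Fin n} {m₁ m₂ : ℕ}
    (ha : IsPoint a) (hc : IsPoint c) (hb : IsPoint b)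
    (h₁ : m₁ ≤ distanceBound j) (h₂ : m₂ ≤ distanceBound j) :
    PrefixDefinable (alternatingPrefix j) fun _ xs =>
      (c xs : ℕ) ≤ a xs + m₁ ∧ (b xs : ℕ) ≤ c xs + m₂ := by
  induction j generalizing k m₁ m₂ with
  | zero =>
    refine prefixDefinable_all_near (M := 0) (fun _ _ _ h h' => ?_) ha hc hb h₁ h₂
    exact (prefixDefinable_const [] False).congr fun w xs => iff_of_false (by omega) id
  | succ j ih =>
    refine prefixDefinable_all_near (M := 2 * distanceBound j)
      (fun ha hc hb h h' => prefixDefinable_ex_near ih ha hc hb h h') ha hc hb ?_ ?_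
    · rw [distanceBound] at h₁
      omega
    · rw [distanceBound] at h₂
      omega

end Distance

/-! ### Upper bound: the separating sentence and its length -/

theorem exists_separating_of_bit {n : ℕ} [NeZero n] {w w' : Fin n → Bool} {i : Fin n}
    (h : w i ≠ w' i) {j : ℕ} (hj : n - 1 ≤ distanceBound j) :
    ∃ φ : lang.Sentence, Separates φ {w} {w'} ∧
      HasPrefix (.ex :: alternatingPrefix j) φ ∧ quantifierNumber φ = 2 * j + 2 := by
  have hS : QFDefinable fun (u : Fin n → Bool) (ys : Fin 1 → Fin n) => u (ys 0) = w i := by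
    cases w i
    · exact (QFDefinable.bit (isPoint_var 0)).not.congr fun u ys => by simp
    · exact QFDefinable.bit (isPoint_var 0)
  have key : PrefixDefinable (k := 0) (.ex :: alternatingPrefix j)
      fun (u : Fin n → Bool) _ => u i = w i := by
    refine ⟨_, .cond hS (prefixDefinable_near j (m₁ := i) (m₂ := n - 1 - i) isPoint_min
      (isPoint_var 0) isPoint_max (by omega) (by omega)) (prefixDefinable_const _ False),
      fun u xs => ?_⟩
    have e : ∀ x : Fin n, (Fin.snoc xs x : Fin 1 → Fin n) 0 = x := fun x => Fin.snoc_last (n := 0) _ _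
    simp only [e]
    constructor
    · intro hu
      exact ⟨i, .inl ⟨hu, by omega, by omega⟩⟩
    · rintro ⟨x, ⟨hxu, this⟩ | ⟨-, h⟩⟩
      swap
      · exact h.elim
      -- The two distances add up to `n - 1`, so neither bound has slack.
      have hxi : x = i := Fin.ext (by omega)
      rwa [hxi] at hxu
  obtain ⟨φ, hφ, hq, hr⟩ := key.exists_formula
  refine ⟨φ, ⟨?_, ?_⟩, hφ, by rw [hq, List.length_cons, length_alternatingPrefix]⟩
  · rintro u rfl
    exact (satisfies_iff_holds _ _).2 ((hr _ _).2 rfl)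
  · rintro u rfl hu
    exact h ((hr _ _).1 ((satisfies_iff_holds _ _).1 hu)).symm

/-- For the least suitable `j`, minimality gives `4 ^ (j - 1) ≤ n` when `j > 0`, so `2 * j ≤ log n +
2`. -/
theorem exists_distanceBound {n : ℕ} (hn : 1 ≤ n) :
    ∃ j : ℕ, n - 1 ≤ distanceBound j ∧ ((2 * j + 2 : ℕ) : ℝ) ≤ Real.logb 2 n + 6 := by
  have hex : ∃ j, n - 1 ≤ distanceBound j := by
    refine ⟨n, ?_⟩
    have h₁ := three_mul_distanceBound n
    have h₂ : n + 1 < 4 ^ (n + 1) := Nat.lt_pow_self (by norm_num)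
    have h₃ : 4 ^ (n + 1) = 4 * 4 ^ n := by ring
    have h₄ : n < 4 ^ n := Nat.lt_pow_self (by norm_num)
    omega
  classical
  refine ⟨Nat.find hex, Nat.find_spec hex, ?_⟩
  have hlog : 0 ≤ Real.logb 2 n := Real.logb_nonneg (by norm_num) (by exact_mod_cast hn)
  rcases hf : Nat.find hex with _ | j
  · push_cast
    linarith
  · have h₁ : ¬ n - 1 ≤ distanceBound j := Nat.find_min hex (by omega)
    have h₂ := three_mul_distanceBound j
    have h₃ : 4 ^ (j + 1) ≤ 4 * n := by omega
    have h₄ : (2 : ℝ) ^ ((2 * j : ℕ) : ℝ) ≤ n := by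
      rw [Real.rpow_natCast, pow_mul]
      have : 4 ^ j ≤ n := by
        rw [pow_succ] at h₃
        omega
      norm_num
      exact_mod_cast this
    have h₅ : ((2 * j : ℕ) : ℝ) ≤ Real.logb 2 n :=
      (Real.le_logb_iff_rpow_le (by norm_num) (by exact_mod_cast hn)).2 h₄
    push_cast at h₅ ⊢
    linarith

/-! ### Lower bound: the Duplicator's strategy -/

/-- Two integers are equal, or both are at least `t`, or both are at most `-t`. -/
def Agree (t x y : ℤ) : Prop :=
  x = y ∨ (t ≤ x ∧ t ≤ y) ∨ (x ≤ -t ∧ y ≤ -t)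

/-- The pairs of positions in `M` respect the order and the positions `p`, `p'` of the bit one. -/
structure PartialIso (M : Set (ℤ × ℤ)) (p p' : ℤ) : Prop where
  lt : ∀ a ∈ M, ∀ b ∈ M, a.1 < b.1 ↔ a.2 < b.2
  one : ∀ a ∈ M, a.1 = p ↔ a.2 = p'

/-- The pairs of positions in `M` respect distances up to the threshold `t`; the threshold is
smaller by one for distances to the bit one, and larger by one for distances across it. -/
structure Similar (t : ℤ) (M : Set (ℤ × ℤ)) (p p' : ℤ) : Prop where
  pair : ∀ a ∈ M, ∀ b ∈ M, Agree t (b.1 - a.1) (b.2 - a.2)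
  one : ∀ a ∈ M, Agree (t - 1) (a.1 - p) (a.2 - p')
  across : ∀ a ∈ M, ∀ b ∈ M, a.1 < p → p < b.1 → Agree (t + 1) (b.1 - a.1) (b.2 - a.2)

section Similar

variable {t x p p' : ℤ} {M : Set (ℤ × ℤ)}

theorem PartialIso.neg (h : PartialIso M p p') :
    PartialIso {a | (-a.1, -a.2) ∈ M} (-p) (-p') where
  lt a ha b hb := by
    have := h.lt _ hb _ ha
    simp only at this
    omega
  one a ha := by
    have := h.one _ ha
    simp only at this
    omega

theorem PartialIso.swap (h : PartialIso M p p') :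
    PartialIso {a | (a.2, a.1) ∈ M} p' p where
  lt _ ha _ hb := (h.lt _ ha _ hb).symm
  one _ ha := (h.one _ ha).symm

/-- Reflection of the strings: it suffices to answer moves to the left of the one. -/
theorem Similar.neg (h : Similar t M p p') : Similar t {a | (-a.1, -a.2) ∈ M} (-p) (-p') where
  pair a ha b hb := by
    have := h.pair _ hb _ ha
    simp only [Agree] at this ⊢
    omega
  one a ha := by
    have := h.one _ ha
    simp only [Agree] at this ⊢
    omega
  across a ha b hb h₁ h₂ := by
    have := h.across _ hb _ ha (by simp only; omega) (by simp only; omega)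
    simp only [Agree] at this ⊢
    omega

/-- Exchanges the two boards. `2 ≤ t` makes the threshold to the one positive, so matched pebbles
lie on the same side of it and `across` transfers. -/
theorem Similar.swap (h : Similar t M p p') (ht : 2 ≤ t) :
    Similar t {a | (a.2, a.1) ∈ M} p' p where
  pair a ha b hb := by
    have := h.pair _ ha _ hb
    simp only [Agree] at this ⊢
    omega
  one a ha := by
    have := h.one _ ha
    simp only [Agree] at this ⊢
    omega
  across a ha b hb h₁ h₂ := by
    have h₃ := h.one _ ha
    have h₄ := h.one _ hb
    simp only [Agree] at h₃ h₄
    have := h.across _ ha _ hb (by simp only; omega) (by simp only; omega)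
    simp only [Agree] at this ⊢
    omega

theorem Similar.partialIso (h : Similar t M p p') (ht : 2 ≤ t) : PartialIso M p p' where
  lt a ha b hb := by
    have := h.pair _ ha _ hb
    simp only [Agree] at this
    omega
  one a ha := by
    have := h.one _ ha
    simp only [Agree] at this
    omega

theorem PartialIso.insert {x' : ℤ} (h : PartialIso M p p') (hp : x = p ↔ x' = p')
    (hM : ∀ a ∈ M, (a.1 < x ↔ a.2 < x') ∧ (x < a.1 ↔ x' < a.2)) :
    PartialIso (insert (x, x') M) p p' where
  lt := by
    rintro a (rfl | ha) b (rfl | hb)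
    · simp
    · exact (hM b hb).2
    · exact (hM a ha).1
    · exact h.lt a ha b hb
  one := by
    rintro a (rfl | ha)
    · exact hp
    · exact h.one a ha

theorem Similar.insert {x' : ℤ} (h : Similar (2 * t) M p p') (ht : 0 ≤ t)
    (hp : Agree (t - 1) (x - p) (x' - p'))
    (hM : ∀ a ∈ M, Agree t (a.1 - x) (a.2 - x') ∧
      ((x < p ∧ p < a.1) ∨ (a.1 < p ∧ p < x) → Agree (t + 1) (a.1 - x) (a.2 - x'))) :
    Similar t (insert (x, x') M) p p' where
  pair := by
    rintro a (rfl | ha) b (rfl | hb)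
    · simp [Agree]
    · exact (hM b hb).1
    · have := (hM a ha).1
      simp only [Agree] at this ⊢
      omega
    · have := h.pair a ha b hb
      simp only [Agree] at this ⊢
      omega
  one := by
    rintro a (rfl | ha)
    · exact hp
    · have := h.one a ha
      simp only [Agree] at this ⊢
      omega
  across := by
    rintro a (rfl | ha) b (rfl | hb) h₁ h₂
    · omega
    · exact (hM b hb).2 (.inl ⟨h₁, h₂⟩)
    · have := (hM a ha).2 (.inr ⟨h₁, h₂⟩)
      simp only [Agree] at this ⊢
      omega
    · have := h.across a ha b hb h₁ h₂
      simp only [Agree] at this ⊢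
      omega

theorem exists_greatest_le (hl : ∃ a ∈ M, a.1 ≤ x) :
    ∃ a ∈ M, a.1 ≤ x ∧ ∀ b ∈ M, b.1 ≤ x → b.1 ≤ a.1 := by
  obtain ⟨a, ha, hax⟩ := hl
  obtain ⟨m, ⟨b, hb, rfl, hbx⟩, hm⟩ := Int.exists_greatest_of_bdd
    (P := fun m => ∃ b ∈ M, b.1 = m ∧ m ≤ x) ⟨x, fun m ⟨_, _, _, h⟩ => h⟩ ⟨a.1, a, ha, rfl, hax⟩
  exact ⟨b, hb, hbx, fun c hc hcx => hm _ ⟨c, hc, rfl, hcx⟩⟩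

/-- A move closer than `t` to a pebble is answered at the same offset; any distance above the old
threshold loses less than `t`. -/
theorem Similar.extend_near (h : Similar (2 * t) M p p') {a : ℤ × ℤ}
    (ha : a ∈ M) (hx : |x - a.1| < t) :
    Similar t (Insert.insert (x, a.2 + (x - a.1)) M) p p' := by
  rw [abs_lt] at hx
  refine h.insert (by omega) ?_ fun b hb => ?_
  · have := h.one a ha
    simp only [Agree] at this ⊢
    omega
  · have h₁ := h.pair a ha b hb
    have h₂ := h.one a ha
    simp only [Agree] at h₁ h₂ ⊢
    refine ⟨by omega, fun hc => ?_⟩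
    omega

theorem Similar.extend_near_one (h : Similar (2 * t) M p p') (hx : |x - p| < t) :
    Similar t (Insert.insert (x, p' + (x - p)) M) p p' := by
  rw [abs_lt] at hx
  refine h.insert (by omega) ?_ fun b hb => ?_
  · simp only [Agree]
    omega
  · have h₁ := h.one b hb
    simp only [Agree] at h₁ ⊢
    refine ⟨by omega, fun hc => ?_⟩
    omega

/-- A move far from every pebble and from the one is answered at distance exactly `t` from the
nearest pebble `a` on the left. Distances from `a` to the pebbles on the right, to the one, and
across it are at least `2 * t`, `2 * t - 1` and `2 * t + 1` on the other board, which leaves `t`, `t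
- 1` and `t + 1`. -/
theorem Similar.exists_extend_far (h : Similar (2 * t) M p p') (ht : 1 ≤ t)
    (hl : ∃ a ∈ M, a.1 ≤ x) (hM : ∀ a ∈ M, t ≤ |x - a.1|) (hx : x + t ≤ p) :
    ∃ x', Similar t (Insert.insert (x, x') M) p p' := by
  obtain ⟨a, ha, hax, hmax⟩ := exists_greatest_le hl
  have h₀ := h.one a ha
  have h₃ := hM a ha
  rw [le_abs] at h₃
  refine ⟨a.2 + t, h.insert (by omega) ?_ fun b hb => ?_⟩
  · simp only [Agree] at h₀ ⊢
    omega
  · have h₁ := h.pair a ha b hb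
    have h₂ := hM b hb
    rw [le_abs] at h₂
    simp only [Agree] at h₁ ⊢
    rcases le_or_gt b.1 x with hbx | hbx
    · have := hmax b hb hbx
      exact ⟨by omega, fun hc => by omega⟩
    · refine ⟨by omega, fun hc => ?_⟩
      have h₄ := h.across a ha b hb (by omega) (by omega)
      simp only [Agree] at h₄
      omega

theorem Similar.exists_extend_last (h : Similar 2 M p p')
    (hl : ∃ a ∈ M, a.1 ≤ x) (hM : ∀ a ∈ M, x ≠ a.1) (hx : x < p) :
    ∃ x', PartialIso (Insert.insert (x, x') M) p p' := by
  obtain ⟨a, ha, hax, hmax⟩ := exists_greatest_le hl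
  have h₀ := h.one a ha
  have h₃ := hM a ha
  simp only [Agree] at h₀
  -- If the one is right after `a.2`, there may be no room before it, and the answer jumps over it.
  -- The next pebble then lies across the one, at distance at least `3` from `a` because `x` and `p`
  -- lie in between; the `across` threshold `2 + 1` keeps it beyond `a.2 + 2`.
  refine ⟨if p' = a.2 + 1 then a.2 + 2 else a.2 + 1,
    (h.partialIso le_rfl).insert (by split_ifs <;> omega) fun b hb => ?_⟩
  have h₁ := h.pair a ha b hb
  have h₂ := hM b hb
  have h₄ := h.one b hb
  simp only [Agree] at h₁ h₄
  rcases le_or_gt b.1 x with hbx | hbx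
  · have := hmax b hb hbx
    split_ifs <;> omega
  · rcases le_or_gt b.1 p with hbp | hbp
    · split_ifs <;> omega
    · have h₅ := h.across a ha b hb (by omega) hbp
      simp only [Agree] at h₅
      split_ifs <;> omega

theorem neg_insert_neg (x x' : ℤ) :
    {a : ℤ × ℤ | (-a.1, -a.2) ∈ insert (-x, x') {a | (-a.1, -a.2) ∈ M}} = insert (x, -x') M := by
  ext ⟨u, v⟩
  simp only [Set.mem_ofPred_eq, Set.mem_insert_iff, Prod.mk.injEq, neg_neg]
  refine or_congr ?_ Iff.rfl
  omega

theorem Similar.exists_extend (h : Similar (2 * t) M p p') (ht : 1 ≤ t)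
    (hl : ∃ a ∈ M, a.1 ≤ x) (hr : ∃ a ∈ M, x ≤ a.1) :
    ∃ x', Similar t (Insert.insert (x, x') M) p p' := by
  by_cases hM : ∃ a ∈ M, |x - a.1| < t
  · obtain ⟨a, ha, hx⟩ := hM
    exact ⟨_, h.extend_near ha hx⟩
  push Not at hM
  rcases lt_or_ge |x - p| t with hx | hx
  · exact ⟨_, h.extend_near_one hx⟩
  rcases le_abs.1 hx with hx | hx
  · obtain ⟨b, hb, hxb⟩ := hr
    obtain ⟨x', h'⟩ := h.neg.exists_extend_far (x := -x) ht
      ⟨(-b.1, -b.2), by simpa using hb, by simpa using hxb⟩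
      (fun a ha => by
        have := hM _ ha
        simp only [le_abs] at this ⊢
        omega) (by omega)
    have := h'.neg
    rw [neg_insert_neg, neg_neg, neg_neg] at this
    exact ⟨_, this⟩
  · exact h.exists_extend_far ht hl hM (by omega)

theorem Similar.exists_extend_partialIso (h : Similar 2 M p p')
    (hl : ∃ a ∈ M, a.1 ≤ x) (hr : ∃ a ∈ M, x ≤ a.1) :
    ∃ x', PartialIso (Insert.insert (x, x') M) p p' := by
  by_cases hM : ∃ a ∈ M, x = a.1
  · obtain ⟨a, ha, rfl⟩ := hM
    refine ⟨a.2, ?_⟩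
    rw [Set.insert_eq_of_mem ha]
    exact h.partialIso le_rfl
  push Not at hM
  rcases lt_trichotomy x p with hx | rfl | hx
  · exact h.exists_extend_last hl hM hx
  · refine ⟨p', (h.partialIso le_rfl).insert (by simp) fun a ha => ?_⟩
    have := h.one a ha
    simp only [Agree] at this
    omega
  · obtain ⟨b, hb, hxb⟩ := hr
    obtain ⟨x', h'⟩ := h.neg.exists_extend_last (x := -x)
      ⟨(-b.1, -b.2), by simpa using hb, by simpa using hxb⟩
      (fun a ha => by
        have := hM _ ha
        simp only at this
        omega) (by omega)
    have := h'.neg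
    rw [neg_insert_neg, neg_neg, neg_neg] at this
    exact ⟨_, this⟩

end Similar

/-- The Duplicator's invariant when `r` rounds are left. -/
def Invariant (r : ℕ) (M : Set (ℤ × ℤ)) (p p' : ℤ) : Prop :=
  -- `Similar 1` would not do at the end: its threshold `0` to the one does not tell whether a
  -- pebble is on the one.
  if r = 0 then PartialIso M p p' else Similar (2 ^ r) M p p'

section Invariant

variable {r : ℕ} {x p p' : ℤ} {M : Set (ℤ × ℤ)}

theorem two_le_two_pow (hr : r ≠ 0) : (2 : ℤ) ≤ 2 ^ r := le_self_pow₀ (by norm_num) hr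

theorem Invariant.partialIso (h : Invariant r M p p') : PartialIso M p p' := by
  unfold Invariant at h
  split_ifs at h with hr
  · exact h
  · exact h.partialIso (two_le_two_pow hr)

theorem Invariant.swap (h : Invariant r M p p') : Invariant r {a | (a.2, a.1) ∈ M} p' p := by
  unfold Invariant at h ⊢
  split_ifs at h ⊢ with hr
  · exact h.swap
  · exact h.swap (two_le_two_pow hr)

theorem Invariant.exists_extend (h : Invariant (r + 1) M p p')
    (hl : ∃ a ∈ M, a.1 ≤ x) (hr : ∃ a ∈ M, x ≤ a.1) :
    ∃ x', Invariant r (insert (x, x') M) p p' := by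
  unfold Invariant at h ⊢
  rw [if_neg r.succ_ne_zero] at h
  split_ifs with h0
  · subst h0
    exact h.exists_extend_partialIso hl hr
  · rw [pow_succ'] at h
    exact h.exists_extend (by have := two_le_two_pow h0; omega) hl hr

theorem swap_insert (x x' : ℤ) :
    {a : ℤ × ℤ | (a.2, a.1) ∈ insert (x', x) {a | (a.2, a.1) ∈ M}} = insert (x, x') M := by
  ext ⟨u, v⟩
  simp only [Set.mem_ofPred_eq, Set.mem_insert_iff, Prod.mk.injEq]
  exact or_congr and_comm Iff.rfl

/-- The Duplicator can answer within the string. -/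
theorem Invariant.exists_extend_fin {n : ℕ} (h : Invariant (r + 1) M p p')
    (h₀ : ((0 : ℤ), (0 : ℤ)) ∈ M) (h₁ : ((n : ℤ) - 1, (n : ℤ) - 1) ∈ M) (x : Fin n) :
    ∃ x' : Fin n, Invariant r (insert ((x : ℤ), (x' : ℤ)) M) p p' := by
  obtain ⟨x', h'⟩ := h.exists_extend (x := (x : ℤ)) ⟨_, h₀, by simp⟩ ⟨_, h₁, by simp only; omega⟩
  -- The end pebbles `(0, 0)` and `(n - 1, n - 1)` confine the answer to the string.
  have h₂ := h'.partialIso.lt _ (Set.mem_insert _ _) _ (Set.mem_insert_of_mem _ h₀)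
  have h₃ := h'.partialIso.lt _ (Set.mem_insert_of_mem _ h₁) _ (Set.mem_insert _ _)
  simp only at h₂ h₃
  lift x' to ℕ using by omega
  exact ⟨⟨x', by omega⟩, h'⟩

end Invariant

/-! ### From the game to sentences -/

section Transfer

variable {n : ℕ} [NeZero n] {p p' : ℤ} {w w' : Fin n → Bool}

theorem realize_mem {M : Set (ℤ × ℤ)} {k : ℕ} {xs xs' : Fin k → Fin n}
    (h₀ : ((0 : ℤ), (0 : ℤ)) ∈ M) (h₁ : ((n : ℤ) - 1, (n : ℤ) - 1) ∈ M)
    (hxs : ∀ i, ((xs i : ℤ), (xs' i : ℤ)) ∈ M) (t : lang.Term (Empty ⊕ Fin k)) :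
    (((@Term.realize lang (Fin n) (toStructure w) _ (Sum.elim default xs) t : Fin n) : ℤ),
      ((@Term.realize lang (Fin n) (toStructure w') _ (Sum.elim default xs') t : Fin n) : ℤ))
        ∈ M := by
  rcases t with (s | i) | ⟨f, ts⟩
  · exact s.elim
  · exact hxs i
  · have hn : ((n - 1 : ℕ) : ℤ) = (n : ℤ) - 1 := by
      have := NeZero.ne n
      omega
    rcases (f : Func _) with _ | _
    · exact h₀
    · rw [← hn] at h₁
      exact h₁

/-- Only a quantifier costs a round; both sides of an implication are played with the same `r`. For
`∀`, one direction answers moves in the second string and so uses the swapped invariant. -/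
theorem holds_iff_holds_of_invariant (hw : ∀ i, w i = true ↔ (i : ℤ) = p)
    (hw' : ∀ i, w' i = true ↔ (i : ℤ) = p') {k : ℕ} (φ : lang.BoundedFormula Empty k)
    {r : ℕ} {M : Set (ℤ × ℤ)} {xs xs' : Fin k → Fin n} (h : Invariant r M p p')
    (h₀ : ((0 : ℤ), (0 : ℤ)) ∈ M) (h₁ : ((n : ℤ) - 1, (n : ℤ) - 1) ∈ M)
    (hxs : ∀ i, ((xs i : ℤ), (xs' i : ℤ)) ∈ M) (hφ : quantifierNumber φ ≤ r) :
    Holds φ w xs ↔ Holds φ w' xs' := by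
  induction φ generalizing r M with
  | falsum => exact Iff.rfl
  | equal t s =>
    have ht := realize_mem (w := w) (w' := w') h₀ h₁ hxs t
    have hs := realize_mem (w := w) (w' := w') h₀ h₁ hxs s
    have e₁ := h.partialIso.lt _ ht _ hs
    have e₂ := h.partialIso.lt _ hs _ ht
    change _ = _ ↔ _ = _
    rw [Fin.ext_iff, Fin.ext_iff]
    simp only at e₁ e₂
    omega
  | rel R ts =>
    rcases (R : Rel _) with _ | _
    · have e := h.partialIso.lt _ (realize_mem (w := w) (w' := w') h₀ h₁ hxs (ts 0)) _
        (realize_mem (w := w) (w' := w') h₀ h₁ hxs (ts 1))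
      simp only [Nat.cast_lt] at e
      exact e
    · have e := h.partialIso.one _ (realize_mem (w := w) (w' := w') h₀ h₁ hxs (ts 0))
      exact (hw _).trans (e.trans (hw' _).symm)
  | imp φ ψ ihφ ihψ =>
    rw [quantifierNumber] at hφ
    rw [holds_imp, holds_imp, ihφ h h₀ h₁ hxs (by omega), ihψ h h₀ h₁ hxs (by omega)]
  | all φ ih =>
    rw [quantifierNumber] at hφ
    obtain ⟨r, rfl⟩ : ∃ s, r = s + 1 := ⟨r - 1, by omega⟩
    have step : ∀ x x' : Fin n, Invariant r (insert ((x : ℤ), (x' : ℤ)) M) p p' →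
        (Holds φ w (Fin.snoc xs x) ↔ Holds φ w' (Fin.snoc xs' x')) := fun x x' h' => by
      refine ih h' (Set.mem_insert_of_mem _ h₀) (Set.mem_insert_of_mem _ h₁) (fun i => ?_)
        (by omega)
      refine Fin.lastCases ?_ (fun i => ?_) i
      · simp
      · simpa using Or.inr (hxs i)
    rw [holds_all, holds_all]
    constructor
    · intro hall x'
      obtain ⟨x, h'⟩ := h.swap.exists_extend_fin h₀ h₁ x'
      have := h'.swap
      rw [swap_insert] at this
      exact (step x x' this).1 (hall x)
    · intro hall x
      obtain ⟨x', h'⟩ := h.exists_extend_fin h₀ h₁ x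
      exact (step x x' h').2 (hall x')

end Transfer

/-- Moving the only bit one from position `2 ^ r - 1` to `2 ^ r` in a string of length at least
`2 ^ (r + 1)` is not seen by sentences with at most `r` quantifiers. -/
theorem satisfies_iff_satisfies_of_quantifierNumber_le {n r : ℕ} [NeZero n] (hr : r ≠ 0)
    (hn : 2 ^ (r + 1) ≤ n) (φ : lang.Sentence) (hφ : quantifierNumber φ ≤ r) :
    Satisfies (fun i : Fin n => decide ((i : ℕ) = 2 ^ r - 1)) φ ↔
      Satisfies (fun i : Fin n => decide ((i : ℕ) = 2 ^ r)) φ := by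
  rw [satisfies_iff_holds, satisfies_iff_holds]
  have hpos : 1 ≤ 2 ^ r := Nat.one_le_two_pow
  refine holds_iff_holds_of_invariant (p := 2 ^ r - 1) (p' := 2 ^ r)
    (M := {((0 : ℤ), (0 : ℤ)), ((n : ℤ) - 1, (n : ℤ) - 1)})
    (fun i => by rw [decide_eq_true_eq]; zify [hpos])
    (fun i => by rw [decide_eq_true_eq]; zify) φ ?_ (by simp) (by simp) (fun i => i.elim0) hφ
  rw [Invariant, if_neg hr]
  rw [pow_succ] at hn
  zify at hn hpos
  have hdiag : ∀ a ∈ ({((0 : ℤ), (0 : ℤ)), ((n : ℤ) - 1, (n : ℤ) - 1)} : Set (ℤ × ℤ)),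
      a.1 = a.2 := by
    rintro a (rfl | rfl) <;> rfl
  refine ⟨fun a ha b hb => .inl (by rw [hdiag a ha, hdiag b hb]), ?_,
    fun a ha b hb _ _ => .inl (by rw [hdiag a ha, hdiag b hb])⟩
  -- The left end is `2 ^ r - 1` or `2 ^ r` away from the one, which just meets the threshold `2 ^ r
  -- - 1`; on the right, `2 ^ (r + 1) ≤ n` gives the same.
  rintro a (rfl | rfl) <;> simp only [Agree] <;> omega

end BinString

theorem mainTheorem4 :
    (∀ (n : ℕ) [NeZero n] (w w' : Fin n → Bool), w ≠ w' →
      ∃ (φ : BinString.lang.Sentence) (P : List BinString.Quantifier),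
        BinString.Separates φ {w} {w'} ∧
        (BinString.quantifierNumber φ : ℝ) ≤ Real.logb 2 n + 6 ∧
        BinString.HasPrefix P φ ∧
        BinString.Alternating P ∧
        P.getLast? = some BinString.Quantifier.all) ∧
    (∃ N : ℕ, ∀ (n : ℕ) [NeZero n], N ≤ n →
      ∃ w w' : Fin n → Bool, w ≠ w' ∧
        ∀ φ : BinString.lang.Sentence, BinString.Separates φ {w} {w'} →
          ⌊Real.logb 2 n⌋ ≤ (BinString.quantifierNumber φ : ℤ)) := by
  constructor
  · intro n _ w w' hne
    obtain ⟨i, hi⟩ := Function.ne_iff.1 hne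
    obtain ⟨j, hj, hlog⟩ := BinString.exists_distanceBound (Nat.one_le_iff_ne_zero.2 (NeZero.ne n))
    obtain ⟨φ, hsep, hP, hq⟩ := BinString.exists_separating_of_bit hi hj
    exact ⟨φ, _, hsep, hq ▸ hlog, hP, BinString.alternating_ex_cons_alternatingPrefix j,
      BinString.getLast?_cons_alternatingPrefix j _⟩
  · refine ⟨4, fun n _ hn => ?_⟩
    -- One round fewer than `⌊log n⌋`, so that failure of every sentence with at most `r`
    -- quantifiers yields the bound.
    obtain ⟨r, hr⟩ : ∃ r, Nat.log 2 n = r + 1 :=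
      ⟨Nat.log 2 n - 1, by have := Nat.log_pos (b := 2) (n := n) (by norm_num) (by omega); omega⟩
    have hr0 : r ≠ 0 := by
      rintro rfl
      have := Nat.lt_pow_succ_log_self (b := 2) (by norm_num) n
      rw [hr] at this
      omega
    have hle : 2 ^ (r + 1) ≤ n := hr ▸ Nat.pow_log_le_self 2 (by omega)
    have hpos : 1 ≤ 2 ^ r := Nat.one_le_two_pow
    refine ⟨fun i => decide ((i : ℕ) = 2 ^ r - 1), fun i => decide ((i : ℕ) = 2 ^ r), fun h => ?_,
      fun φ hφ => ?_⟩
    · have h' := congrFun h ⟨2 ^ r, by rw [pow_succ] at hle; omega⟩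
      simp only [decide_eq_decide, iff_true] at h'
      omega
    · have hfloor : ⌊Real.logb 2 n⌋ = (r + 1 : ℕ) := by
        have := Real.floor_logb_natCast (b := 2) (r := (n : ℝ)) (by positivity)
        rw [Nat.cast_ofNat] at this
        rw [this, Int.log_natCast, hr]
      rw [hfloor]
      by_contra! hlt
      exact hφ.2 _ rfl ((BinString.satisfies_iff_satisfies_of_quantifierNumber_le hr0 hle φ
        (by omega)).1 (hφ.1 _ rfl))
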